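/- Let $(W,S)$ be a finite Coxeter system with length function $\ell$. For $I\subseteq S$ let $X_I=\{w\in W:\ \ell(ws)>\ell(w)\text{ for all }s\in I\}$ and $x_I=\sum_{w\in X_I}w\in\mathbb{Q}W$. Let $\Sigma(W)=\bigoplus_{I\subseteq S}\mathbb{Q}x_I\subseteq\mathbb{Q}W$ be Solomon's descent algebra, and let $\Sigma^+(W)$ be the set of all $\sum_{I\subseteq S}\xi_I x_I$ with $\xi_I\in\mathbb{Q}_{\ge 0}$ for all $I$. For $b\in\Sigma(W)$ write $Z(b)=\{x\in\Sigma(W): xb=bx\}$ for the centralizer of $b$ in $\Sigma(W)$. Let $a=\sum_{I\subseteq S}\xi_I x_I\in\Sigma^+(W)$. (1) For every integer $n\ge 1$, $Z(a^n)=Z(a)$. (2) For $I,J\subseteq S$ write $I\equiv J$ if $J=wIw^{-1}$ for some $w\in W$, and write $I\preceq J$ if there are $I'\equiv I$ and $J'\equiv J$ with $I'\subseteq J'\subseteq S$. Let $\mathcal F_{\mathrm{eq}}(a)$ be the set of all $I\subseteq S$ such that $I\preceq J$ for some $J\subseteq S$ with $\xi_J\neq 0$, and let $\mu_a:\Sigma(W)\to\Sigma(W)$,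 $x\mapsto ax-xa$. Then $$\dim_{\mathbb Q} Z(a)=2^{|S|}-|\mathcal F_{\mathrm{eq}}(a)|+\dim_{\mathbb Q}\Sigma(W)a-\dim_{\mathbb Q}\bigl(\operatorname{im}\mu_a\cap\Sigma(W)a\bigr).$$ -/

import Mathlib

namespace CoxeterSystem

noncomputable section

variable {B W : Type*} [Group W] {M : CoxeterMatrix B} (cs : CoxeterSystem M W)

/-- The set `X_I` of all `w` such that `w s > w` for every simple reflection `s` in `I`. For a
simple reflection `s`, `w s > w` in the Bruhat order means that `w s` is longer than `w`. -/
def minCosetReps (I : Finset B) : Set W :=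
  {w | ∀ i ∈ I, cs.length w < cs.length (w * cs.simple i)}

open Classical in
/-- The element `x_I`, the sum of all elements of `X_I`, of the rational group algebra. -/
def descentElt [Fintype W] (I : Finset B) : MonoidAlgebra ℚ W :=
  ∑ w : W with w ∈ cs.minCosetReps I, MonoidAlgebra.of ℚ W w

/-- Solomon's descent algebra `Σ(W)`, as a subspace of the group algebra: the span of all
the `x_I`. -/
def descentSpace [Fintype W] : Submodule ℚ (MonoidAlgebra ℚ W) :=
  Submodule.span ℚ (Set.range cs.descentElt)

/-- The set `Σ⁺(W)` of non-negative rational linear combinations of the elements `x_I`. -/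
def descentPos [Fintype B] [Fintype W] : Set (MonoidAlgebra ℚ W) :=
  {a | ∃ ξ : Finset B → ℚ, (∀ I, 0 ≤ ξ I) ∧ a = ∑ I, ξ I • cs.descentElt I}

/-- The centralizer of `a` in `Σ(W)`. -/
def descentCentralizer [Fintype W] (a : MonoidAlgebra ℚ W) : Submodule ℚ (MonoidAlgebra ℚ W) :=
  cs.descentSpace ⊓ Subalgebra.toSubmodule (Subalgebra.centralizer ℚ {a})

/-- The left ideal `Σ(W) a`. -/
def descentMulRight [Fintype W] (a : MonoidAlgebra ℚ W) : Submodule ℚ (MonoidAlgebra ℚ W) :=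
  cs.descentSpace.map (LinearMap.mulRight ℚ a)

/-- The image of the map `x ↦ a x - x a` on `Σ(W)`. -/
def descentCommRange [Fintype W] (a : MonoidAlgebra ℚ W) : Submodule ℚ (MonoidAlgebra ℚ W) :=
  cs.descentSpace.map (LinearMap.mulLeft ℚ a - LinearMap.mulRight ℚ a)

/-- The relation `I ≡ J`: some `w` satisfies `J = w I w⁻¹`, as sets of simple reflections. -/
def SubsetConj (I J : Finset B) : Prop :=
  ∃ w : W, cs.simple '' (J : Set B) = (fun v => w * v * w⁻¹) '' (cs.simple '' (I : Set B))

/-- The relation which inclusion induces on the classes of subsets under `≡`, read on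
representatives: the class of `I` lies below the class of `J`. -/
def ClassLE (I J : Finset B) : Prop :=
  ∃ I' J' : Finset B, cs.SubsetConj I I' ∧ cs.SubsetConj J J' ∧ I' ⊆ J'

/-- The set `F_eq(a)` of an element `a = ∑ ξ_J x_J`, as a function of its coordinates `ξ`: all
subsets `I` whose class lies below the class of some `J` with `ξ_J ≠ 0`. -/
def eqSaturation (ξ : Finset B → ℚ) : Set (Finset B) :=
  {I | ∃ J, ξ J ≠ 0 ∧ cs.ClassLE I J}

end

end CoxeterSystem

/-! By Solomon's product formula, `x_I x_J` is a sum of `x_K` with `K ⊆ J` and `K ⪯ I`, and `x_J`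
itself occurs exactly when `J ⪯ I`. In the basis of the `x_J`, left multiplication by an element of
`Σ(W)` is therefore triangular for inclusion. For `a ∈ Σ⁺(W)` nothing cancels: with `F = F_eq(a)`,
the matrix `A` has zero rows outside the lower set `F` and positive diagonal entries on `F`.

For (1), let `X` be the matrix of an `x` commuting with `aⁿ`, and put `Y = AX - XA`. Telescoping
gives `∑ Aᵖ Y Aⁿ⁻¹⁻ᵖ = 0`. By induction on `|J| - |I|`, the `(I,J)` entry of this sum is `Y_IJ`
times a sum of products of diagonal entries, which is positive for `I ∈ F`; the rows of `Y` outside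
`F` vanish anyway. So `Y = 0`, and the left regular representation is faithful.

For (2), both `aΣ(W)` and `Σ(W)a` lie in the span of the `x_I` with `I ∈ F`, and triangularity makes
`aΣ(W)` all of it. Hence `im μ_a + Σ(W)a = aΣ(W) + Σ(W)a` has dimension `|F|`; the formula follows
from the dimension of a sum and rank-nullity for `μ_a`. -/

namespace CoxeterSystem

/-! ### The inversion cocycle and the exchange condition -/

section Cocycle

variable {B W : Type*} [Group W] {M : CoxeterMatrix B} (cs : CoxeterSystem M W)

open Classical in
/-- The map `(t, ε) ↦ (sᵢ t sᵢ, ε + [t = sᵢ])`. -/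
noncomputable def signMap (i : B) : Function.End (W × ZMod 2) := fun p =>
  (cs.simple i * p.1 * cs.simple i, p.2 + if p.1 = cs.simple i then 1 else 0)

-- The explicit count needed for the braid relations: the factors of the alternating product meet in
-- turn the elements `p⁻ˡ sⱼ`, `p = sᵢ sⱼ`, of the dihedral subgroup.
open Classical in
theorem signMap_mul_pow_apply (i j : B) (k : ℕ) (t : W) (e : ZMod 2) :
    ((cs.signMap i * cs.signMap j) ^ k) (t, e) =
      ((cs.simple i * cs.simple j) ^ k * t * ((cs.simple i * cs.simple j) ^ k)⁻¹,
        e + ∑ l ∈ Finset.range (2 * k),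
          if t = ((cs.simple i * cs.simple j) ^ l)⁻¹ * cs.simple j then 1 else 0) := by
  induction k with
  | zero => simp; rfl
  | succ k ih =>
    set a := cs.simple i with ha
    set b := cs.simple j with hb
    have haa : a * a = 1 := cs.simple_mul_simple_self i
    have hbb : b * b = 1 := cs.simple_mul_simple_self j
    have hai : a⁻¹ = a := cs.inv_simple i
    have hbi : b⁻¹ = b := cs.inv_simple j
    set p := a * b with hp
    have hpi : p⁻¹ = b * a := by rw [hp, mul_inv_rev, hai, hbi]
    have hbp : b * p * b = p⁻¹ := by rw [hpi, hp, mul_assoc, mul_assoc, hbb, mul_one]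
    have hbpk : ∀ k : ℕ, b * p ^ k = (p ^ k)⁻¹ * b := by
      intro k
      induction k with
      | zero => simp
      | succ k ih =>
        have h1 : b * p = p⁻¹ * b := by rw [← hbp, mul_assoc, hbb, mul_one]
        have h2 : (p ^ (k + 1))⁻¹ = (p ^ k)⁻¹ * p⁻¹ := by rw [pow_succ', mul_inv_rev]
        rw [h2, pow_succ, ← mul_assoc, ih, mul_assoc, h1, mul_assoc]
    have e1 : p ^ k * t * (p ^ k)⁻¹ = b ↔ t = (p ^ (2 * k))⁻¹ * b := by
      rw [mul_inv_eq_iff_eq_mul, hbpk, ← eq_inv_mul_iff_mul_eq, ← mul_assoc, two_mul, pow_add,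
        mul_inv_rev]
    have e2 : b * (p ^ k * t * (p ^ k)⁻¹) * b = a ↔ t = (p ^ (2 * k + 1))⁻¹ * b := by
      have h3 : b * (p ^ k * t * (p ^ k)⁻¹) * b = a ↔ p ^ k * t * (p ^ k)⁻¹ = p⁻¹ * b := by
        rw [hpi]
        constructor
        · intro h
          rw [← h]
          simp only [← mul_assoc, hbb, one_mul]
          rw [mul_assoc _ b b, hbb, mul_one]
        · intro h
          rw [h]
          simp only [← mul_assoc, hbb, one_mul]
          rw [mul_assoc _ b b, hbb, mul_one]
      rw [h3, mul_inv_eq_iff_eq_mul, mul_assoc, hbpk, ← eq_inv_mul_iff_mul_eq]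
      have : (p ^ (2 * k + 1))⁻¹ * b = (p ^ k)⁻¹ * (p⁻¹ * ((p ^ k)⁻¹ * b)) := by
        rw [show 2 * k + 1 = k + 1 + k by ring, pow_add, pow_succ]
        simp only [mul_inv_rev, mul_assoc]
      rw [this]
    rw [pow_succ', show 2 * (k + 1) = 2 * k + 1 + 1 by ring, Finset.sum_range_succ,
      Finset.sum_range_succ]
    change cs.signMap i (cs.signMap j (((cs.signMap i * cs.signMap j) ^ k) (t, e))) = _
    rw [ih]
    simp only [signMap, ← ha, ← hb, e1, e2]
    refine Prod.ext ?_ ?_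
    · simp only [pow_succ', mul_inv_rev, hp, hai, hbi, mul_assoc]
    · simp only [add_assoc]

theorem isLiftable_signMap : M.IsLiftable cs.signMap := by
  classical
  intro i j
  funext ⟨t, e⟩
  rw [signMap_mul_pow_apply, cs.simple_mul_simple_pow]
  -- The summand has period `M i j` in `l`, so the two halves of the range cancel modulo 2.
  have : ∑ l ∈ Finset.range (2 * M i j),
      (if t = ((cs.simple i * cs.simple j) ^ l)⁻¹ * cs.simple j then (1 : ZMod 2) else 0) = 0 := by
    rw [two_mul, Finset.sum_range_add]
    simp only [pow_add, cs.simple_mul_simple_pow, one_mul]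
    exact CharTwo.add_self_eq_zero _
  rw [this]
  simp
  rfl

/-- The action of `W` on pairs `(t, ε)`, which on reflections `t` is the action on signed
reflections (that is, on abstract roots). -/
noncomputable def signHom : W →* Function.End (W × ZMod 2) :=
  cs.lift ⟨cs.signMap, cs.isLiftable_signMap⟩

theorem signHom_simple (i : B) : cs.signHom (cs.simple i) = cs.signMap i :=
  cs.lift_apply_simple cs.isLiftable_signMap i

/-- The inversion cocycle: for a reflection `t` it is `1` if `ℓ (w t) < ℓ w` and `0` otherwise. -/
noncomputable def invCocycle (w t : W) : ZMod 2 := (cs.signHom w (t, 0)).2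

theorem signHom_apply (w t : W) (e : ZMod 2) :
    cs.signHom w (t, e) = (w * t * w⁻¹, e + cs.invCocycle w t) := by
  classical
  have key : ∀ w : W, ∃ c : W → ZMod 2, ∀ t e, cs.signHom w (t, e) = (w * t * w⁻¹, e + c t) := by
    intro w
    induction w using cs.simple_induction_left with
    | one => exact ⟨fun _ => 0, fun t e => by rw [map_one]; simp; rfl⟩
    | mul_simple_left w i ih =>
      obtain ⟨c, hc⟩ := ih
      refine ⟨fun t => c t + if w * t * w⁻¹ = cs.simple i then 1 else 0, fun t e => ?_⟩
      rw [map_mul]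
      change cs.signHom (cs.simple i) (cs.signHom w (t, e)) = _
      rw [hc, signHom_simple]
      simp [signMap, mul_assoc, add_assoc]
  obtain ⟨c, hc⟩ := key w
  have : cs.invCocycle w t = c t := by simp [invCocycle, hc]
  rw [hc, this]

theorem invCocycle_one (t : W) : cs.invCocycle 1 t = 0 := by
  rw [invCocycle, map_one]; rfl

theorem invCocycle_mul (u v t : W) :
    cs.invCocycle (u * v) t = cs.invCocycle v t + cs.invCocycle u (v * t * v⁻¹) := by
  rw [invCocycle, map_mul]
  change (cs.signHom u (cs.signHom v (t, 0))).2 = _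
  rw [signHom_apply, signHom_apply]
  simp

open Classical in
theorem invCocycle_simple (i : B) (t : W) :
    cs.invCocycle (cs.simple i) t = if t = cs.simple i then 1 else 0 := by
  simp [invCocycle, signHom_simple, signMap]

theorem invCocycle_inv (d t : W) : cs.invCocycle d⁻¹ (d * t * d⁻¹) = cs.invCocycle d t := by
  have h := cs.invCocycle_mul d⁻¹ d t
  rw [inv_mul_cancel, invCocycle_one] at h
  exact ((CharTwo.add_eq_zero).mp h.symm).symm

/-- For `t = u sᵢ u⁻¹` the contributions of `u` and `u⁻¹` are equal and cancel modulo 2; only that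
of `sᵢ` remains. -/
theorem invCocycle_self {t : W} (ht : cs.IsReflection t) : cs.invCocycle t t = 1 := by
  obtain ⟨u, i, rfl⟩ := ht
  have h : ∀ x : W, u⁻¹ * (u * x * u⁻¹) * u⁻¹⁻¹ = x := fun x => by group
  rw [invCocycle_mul, invCocycle_inv, h, invCocycle_mul, invCocycle_simple]
  have h' : cs.simple i * cs.simple i * (cs.simple i)⁻¹ = cs.simple i := by simp
  rw [h', if_pos rfl, add_comm 1, ← add_assoc, CharTwo.add_self_eq_zero, zero_add]

theorem mem_rightInvSeq_of_invCocycle_ne_zero (ω : List B) {t : W}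
    (h : cs.invCocycle (cs.wordProd ω) t ≠ 0) : t ∈ cs.rightInvSeq ω := by
  induction ω with
  | nil => simp [invCocycle_one] at h
  | cons i ω ih =>
    rw [rightInvSeq, List.mem_cons]
    by_cases h1 : cs.invCocycle (cs.wordProd ω) t = 0
    · left
      rw [wordProd_cons, invCocycle_mul, h1, zero_add, invCocycle_simple] at h
      have := of_not_not fun hh => h (if_neg hh)
      rw [← this]; group
    · exact Or.inr (ih h1)

theorem length_mul_lt_of_invCocycle_ne_zero {w t : W} (h : cs.invCocycle w t ≠ 0) :
    cs.length (w * t) < cs.length w := by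
  obtain ⟨ω, hω, rfl⟩ := cs.exists_isReduced w
  exact (cs.isRightInversion_of_mem_rightInvSeq hω
    (cs.mem_rightInvSeq_of_invCocycle_ne_zero ω h)).2

/-- The values at `t` for `w` and `w t` differ by 1, and a nonzero value forces the length to drop.
-/
theorem invCocycle_eq_zero_iff {w t : W} (ht : cs.IsReflection t) :
    cs.invCocycle w t = 0 ↔ cs.length w < cs.length (w * t) := by
  constructor
  · intro h
    have h1 : cs.invCocycle (w * t) t ≠ 0 := by
      rw [invCocycle_mul, cs.invCocycle_self ht]
      simp [h]
    have := cs.length_mul_lt_of_invCocycle_ne_zero h1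
    rwa [mul_assoc, ht.mul_self, mul_one] at this
  · intro h
    by_contra h1
    exact absurd (cs.length_mul_lt_of_invCocycle_ne_zero h1) (by omega)

theorem mem_minCosetReps_iff {I : Finset B} {w : W} :
    w ∈ cs.minCosetReps I ↔ ∀ i ∈ I, cs.invCocycle w (cs.simple i) = 0 :=
  forall₂_congr fun i _ => (cs.invCocycle_eq_zero_iff (cs.isReflection_simple i)).symm

end Cocycle

/-! ### The geometric representation -/

section Geometric

variable {B W : Type*} [Group W] {M : CoxeterMatrix B} (cs : CoxeterSystem M W)

/-- The simple coroots of the geometric representation. -/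
noncomputable def geomCoroot (M : CoxeterMatrix B) (i : B) : Module.Dual ℝ (B →₀ ℝ) :=
  Finsupp.linearCombination ℝ fun j => -2 * Real.cos (Real.pi / M i j)

theorem geomCoroot_single (M : CoxeterMatrix B) (i j : B) :
    geomCoroot M i (Finsupp.single j 1) = -2 * Real.cos (Real.pi / M i j) := by
  simp [geomCoroot]

theorem geomCoroot_self (M : CoxeterMatrix B) (i : B) :
    geomCoroot M i (Finsupp.single i 1) = 2 := by
  simp [geomCoroot_single]

/-- The simple reflections of the geometric representation. -/
noncomputable def geomReflection (M : CoxeterMatrix B) (i : B) : (B →₀ ℝ) ≃ₗ[ℝ] (B →₀ ℝ) :=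
  Module.reflection (geomCoroot_self M i)

open Polynomial.Chebyshev in
theorem isLiftable_geomReflection (M : CoxeterMatrix B) : M.IsLiftable (geomReflection M) := by
  intro i j
  by_cases hij : i = j
  · subst hij
    rw [M.diagonal, pow_one]
    ext1 x
    exact Module.involutive_reflection (geomCoroot_self M i) x
  refine LinearEquiv.ext fun z => ?_
  rw [geomReflection, geomReflection]
  have hm1 : M i j ≠ 1 := M.off_diagonal i j hij
  have hx : geomCoroot M i (Finsupp.single j 1) = -2 * Real.cos (Real.pi / M i j) :=
    geomCoroot_single M i j
  have hy : geomCoroot M j (Finsupp.single i 1) = -2 * Real.cos (Real.pi / M i j) := by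
    rw [geomCoroot_single, M.symmetric]
  have ht : 2 * Real.cos (2 * Real.pi / M i j) =
      geomCoroot M i (Finsupp.single j 1) * geomCoroot M j (Finsupp.single i 1) - 2 := by
    rw [hx, hy, mul_div_assoc, Real.cos_two_mul]; ring
  rw [Module.reflection_mul_reflection_pow_apply (geomCoroot_self M i) (geomCoroot_self M j)
    (M i j) z _ ht]
  generalize hm : M i j = m at *
  have hcase : m = 0 ∨ m = 2 ∨ 3 ≤ m := by omega
  rcases hcase with h0 | h2 | h3
  · subst h0
    simp
  -- Here `θ = 2π/m = π` has zero sine, so the quotient formula for the Chebyshev values is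
  -- unavailable.
  · subst h2
    have hc : Real.cos (2 * Real.pi / (2 : ℕ)) = -1 := by
      rw [show 2 * Real.pi / (2 : ℕ) = Real.pi by push_cast; ring, Real.cos_pi]
    have hd : Real.cos (Real.pi / (2 : ℕ)) = 0 := by
      push_cast; exact Real.cos_pi_div_two
    rw [hx, hy, hc, hd]
    norm_num
    module
  · set θ : ℝ := 2 * Real.pi / m with hθ
    have hmpos : (0 : ℝ) < m := by positivity
    have hmθ : m * θ = 2 * Real.pi := by rw [hθ]; field_simp
    have hs : Real.sin θ ≠ 0 := by
      apply ne_of_gt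
      apply Real.sin_pos_of_pos_of_lt_pi
      · positivity
      · rw [hθ, div_lt_iff₀ hmpos]
        have : (3 : ℝ) ≤ m := by exact_mod_cast h3
        nlinarith [Real.pi_pos]
    have hS : ∀ n : ℤ, (S ℝ n).eval (2 * Real.cos θ) = Real.sin ((n + 1) * θ) / Real.sin θ :=
      fun n => by rw [eq_div_iff hs, S_two_mul_real_cos]
    -- These are the coefficients in the formula for the `m`-th power. For even `m` the sine is
    -- taken at `π`; for odd `m` two sines at angles adding up to `2π` cancel.
    have hzero : ((S ℝ (((m : ℤ) - 2) / 2)).eval (2 * Real.cos θ) = 0 ∧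
          (S ℝ (((m : ℤ) - 1) / 2)).eval (2 * Real.cos θ) = 0) ∨
        ((S ℝ (((m : ℤ) - 1) / 2)).eval (2 * Real.cos θ) +
            (S ℝ (((m : ℤ) - 3) / 2)).eval (2 * Real.cos θ) = 0 ∧
          (S ℝ ((m : ℤ) / 2)).eval (2 * Real.cos θ) +
            (S ℝ (((m : ℤ) - 2) / 2)).eval (2 * Real.cos θ) = 0) := by
      rcases Nat.even_or_odd' m with ⟨k, hk | hk⟩
      · left
        have e1 : ((m : ℤ) - 2) / 2 = k - 1 := by omega
        have e2 : ((m : ℤ) - 1) / 2 = k - 1 := by omega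
        have : Real.sin ((((k : ℤ) - 1 : ℤ) + 1 : ℝ) * θ) = 0 := by
          have : (((k : ℤ) - 1 : ℤ) + 1 : ℝ) * θ = Real.pi := by
            have : (m : ℝ) = 2 * k := by exact_mod_cast hk
            rw [this] at hmθ
            push_cast; linarith
          rw [this, Real.sin_pi]
        rw [e1, e2, hS, this]
        simp
      · right
        have e1 : ((m : ℤ) - 1) / 2 = k := by omega
        have e2 : ((m : ℤ) - 3) / 2 = k - 1 := by omega
        have e3 : (m : ℤ) / 2 = k := by omega
        have e4 : ((m : ℤ) - 2) / 2 = k - 1 := by omega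
        have : Real.sin (((k : ℤ) + 1 : ℝ) * θ) +
            Real.sin ((((k : ℤ) - 1 : ℤ) + 1 : ℝ) * θ) = 0 := by
          have : ((k : ℤ) + 1 : ℝ) * θ = 2 * Real.pi - (((k : ℤ) - 1 : ℤ) + 1 : ℝ) * θ := by
            have : (m : ℝ) = 2 * k + 1 := by exact_mod_cast hk
            rw [this] at hmθ
            push_cast; linarith
          rw [this, Real.sin_two_pi_sub]
          ring
        rw [e1, e2, e3, e4, hS, hS, ← add_div, this]
        simp
    rcases hzero with ⟨h, h'⟩ | ⟨h, h'⟩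
    · simp [h, h']
    · simp [h, h']

/-- The geometric representation. -/
noncomputable def geomRep : W →* ((B →₀ ℝ) ≃ₗ[ℝ] (B →₀ ℝ)) :=
  cs.lift ⟨geomReflection M, isLiftable_geomReflection M⟩

theorem geomRep_simple (i : B) (v : B →₀ ℝ) :
    cs.geomRep (cs.simple i) v = v - geomCoroot M i v • Finsupp.single i 1 := by
  rw [geomRep, cs.lift_apply_simple (isLiftable_geomReflection M) i]
  exact Module.reflection_apply _ _

end Geometric

/-! ### Parabolic subgroups and minimal coset representatives -/

section Parabolic

variable {B W : Type*} [Group W] {M : CoxeterMatrix B} (cs : CoxeterSystem M W)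

/-- The standard parabolic subgroup `W_I`. -/
def parabolic (I : Finset B) : Subgroup W :=
  Subgroup.closure (cs.simple '' (I : Set B))

theorem simple_mem_parabolic {I : Finset B} {i : B} (hi : i ∈ I) :
    cs.simple i ∈ cs.parabolic I :=
  Subgroup.subset_closure ⟨i, hi, rfl⟩

theorem parabolic_induction {I : Finset B} {p : W → Prop} (one : p 1)
    (mul : ∀ w i, i ∈ I → w ∈ cs.parabolic I → p w → p (w * cs.simple i))
    {z : W} (hz : z ∈ cs.parabolic I) : p z := by
  refine Subgroup.closure_induction_right (p := fun x _ => p x) one ?_ ?_ hz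
  · rintro x hx _ ⟨i, hi, rfl⟩ h
    exact mul x i hi hx h
  · rintro x hx _ ⟨i, hi, rfl⟩ h
    rw [cs.inv_simple]
    exact mul x i hi hx h

/-- If `j ∉ I`, then `W_I` preserves the `j`-th coordinate in the geometric representation, whereas
`sⱼ` negates the `j`-th basis vector. -/
theorem simple_mem_parabolic_iff {I : Finset B} {j : B} :
    cs.simple j ∈ cs.parabolic I ↔ j ∈ I := by
  refine ⟨fun h => ?_, cs.simple_mem_parabolic⟩
  by_contra hj
  have key : ∀ v, cs.geomRep (cs.simple j) v j = v j := by
    refine cs.parabolic_induction (p := fun w => ∀ v, cs.geomRep w v j = v j) ?_ ?_ h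
    · simp
    · intro w i hi _ ih v
      have hij : i ≠ j := fun e => hj (e ▸ hi)
      rw [map_mul, LinearEquiv.mul_apply, ih, geomRep_simple]
      simp [hij]
  have := key (Finsupp.single j 1)
  rw [geomRep_simple, geomCoroot_self] at this
  norm_num at this

theorem mem_parabolic_of_invCocycle_ne_zero {I : Finset B} {z t : W} (hz : z ∈ cs.parabolic I)
    (h : cs.invCocycle z t ≠ 0) : t ∈ cs.parabolic I := by
  revert t
  refine cs.parabolic_induction (p := fun z => ∀ {t}, cs.invCocycle z t ≠ 0 → t ∈ cs.parabolic I)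
    ?_ ?_ hz
  · intro t h
    exact absurd (cs.invCocycle_one t) h
  · intro w i hi hw ih t h
    have hs := cs.simple_mem_parabolic hi
    rw [invCocycle_mul, invCocycle_simple] at h
    by_cases ht : t = cs.simple i
    · exact ht ▸ hs
    · rw [if_neg ht, zero_add] at h
      have := ih h
      have h2 := mul_mem (mul_mem (inv_mem hs) this) hs
      convert h2 using 1
      group

theorem eq_one_of_mem_parabolic_of_mem_minCosetReps {I : Finset B} {z : W}
    (hz : z ∈ cs.parabolic I) (hz' : z ∈ cs.minCosetReps I) : z = 1 := by
  by_contra h1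
  obtain ⟨j, hj⟩ := cs.exists_rightDescent_of_ne_one h1
  have hj' : cs.invCocycle z (cs.simple j) ≠ 0 := by
    rw [Ne, cs.invCocycle_eq_zero_iff (cs.isReflection_simple j)]
    exact not_lt_of_gt hj
  exact hj' (cs.mem_minCosetReps_iff.mp hz' j
    (cs.simple_mem_parabolic_iff.mp (cs.mem_parabolic_of_invCocycle_ne_zero hz hj')))

/-- Take `x` of minimal length in `g W_I`: a nonzero cocycle value at some `t ∈ W_I` would make `x
t` shorter. -/
theorem exists_mul_parabolic (I : Finset B) (g : W) :
    ∃ x z, g = x * z ∧ z ∈ cs.parabolic I ∧ ∀ t ∈ cs.parabolic I, cs.invCocycle x t = 0 := by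
  obtain ⟨z, hz⟩ : ∃ z : cs.parabolic I, ∀ z' : cs.parabolic I,
      cs.length (g * z) ≤ cs.length (g * z') :=
    ⟨_, fun z' => Function.argmin_le (fun z : cs.parabolic I => cs.length (g * z)) z'⟩
  refine ⟨g * z, (z : W)⁻¹, by group, inv_mem z.2, fun t ht => ?_⟩
  by_contra h
  have h1 := cs.length_mul_lt_of_invCocycle_ne_zero h
  have h2 := hz (z * ⟨t, ht⟩)
  rw [Subgroup.coe_mul, ← mul_assoc] at h2
  exact absurd h1 (not_lt_of_ge h2)

theorem invCocycle_eq_zero_of_mem_minCosetReps {I : Finset B} {x t : W}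
    (hx : x ∈ cs.minCosetReps I) (ht : t ∈ cs.parabolic I) : cs.invCocycle x t = 0 := by
  obtain ⟨y, z, rfl, hz, hy⟩ := cs.exists_mul_parabolic I x
  have hz1 : z ∈ cs.minCosetReps I := by
    rw [mem_minCosetReps_iff] at hx ⊢
    intro i hi
    have h := hx i hi
    rwa [invCocycle_mul, hy _ (mul_mem (mul_mem hz (cs.simple_mem_parabolic hi)) (inv_mem hz)),
      add_zero] at h
  rw [cs.eq_one_of_mem_parabolic_of_mem_minCosetReps hz hz1, mul_one]
  exact hy t ht

/-- Since `x` has no inversions in `W_I`, right multiplication by `sᵢ` raises or lowers the lengths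
of `x w` and `w` together. -/
theorem length_mul_of_mem_minCosetReps {I : Finset B} {x z : W} (hx : x ∈ cs.minCosetReps I)
    (hz : z ∈ cs.parabolic I) : cs.length (x * z) = cs.length x + cs.length z := by
  refine cs.parabolic_induction (p := fun z => cs.length (x * z) = cs.length x + cs.length z)
    (by simp) ?_ hz
  intro w i hi hw ih
  have hr := cs.isReflection_simple i
  have hc : cs.invCocycle (x * w) (cs.simple i) = cs.invCocycle w (cs.simple i) := by
    rw [invCocycle_mul, cs.invCocycle_eq_zero_of_mem_minCosetReps hx
      (mul_mem (mul_mem hw (cs.simple_mem_parabolic hi)) (inv_mem hw)), add_zero]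
  have hiff : cs.length (x * w) < cs.length (x * w * cs.simple i) ↔
      cs.length w < cs.length (w * cs.simple i) := by
    rw [← cs.invCocycle_eq_zero_iff hr, ← cs.invCocycle_eq_zero_iff hr, hc]
  have h1 := cs.length_mul_simple (x * w) i
  have h2 := cs.length_mul_simple w i
  rw [← mul_assoc]
  omega

/-- Each coset of `W_I` has exactly one representative in `X_I`. -/
theorem existsUnique_minCosetReps (I : Finset B) (g : W) :
    ∃! x, x ∈ cs.minCosetReps I ∧ x⁻¹ * g ∈ cs.parabolic I := by
  obtain ⟨x, z, rfl, hz, hx⟩ := cs.exists_mul_parabolic I g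
  have hxI : x ∈ cs.minCosetReps I :=
    cs.mem_minCosetReps_iff.mpr fun i hi => hx _ (cs.simple_mem_parabolic hi)
  refine ⟨x, ⟨hxI, by simpa using hz⟩, ?_⟩
  rintro y ⟨hy, hyz⟩
  have hmem : x⁻¹ * y ∈ cs.parabolic I := by
    have := mul_mem hz (inv_mem hyz)
    convert this using 1
    group
  -- Passing from `x` to `y` and from `y` to `x` both add `ℓ(x⁻¹ y)` to the length, so it is zero.
  have h1 := cs.length_mul_of_mem_minCosetReps hxI hmem
  have h2 := cs.length_mul_of_mem_minCosetReps hy (inv_mem hmem)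
  rw [mul_inv_cancel_left] at h1
  rw [mul_inv_rev, inv_inv, mul_inv_cancel_left] at h2
  have h3 : cs.length (x⁻¹ * y) = 0 := by omega
  rw [length_eq_zero_iff, inv_mul_eq_one] at h3
  exact h3.symm

/-- The representative in `X_I` of the coset `g W_I`. -/
noncomputable def cosetRep (I : Finset B) (g : W) : W :=
  (cs.existsUnique_minCosetReps I g).choose

theorem cosetRep_mem (I : Finset B) (g : W) : cs.cosetRep I g ∈ cs.minCosetReps I :=
  (cs.existsUnique_minCosetReps I g).choose_spec.1.1

theorem cosetRep_inv_mul_mem (I : Finset B) (g : W) :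
    (cs.cosetRep I g)⁻¹ * g ∈ cs.parabolic I :=
  (cs.existsUnique_minCosetReps I g).choose_spec.1.2

theorem cosetRep_eq {I : Finset B} {g x : W} (hx : x ∈ cs.minCosetReps I)
    (h : x⁻¹ * g ∈ cs.parabolic I) : cs.cosetRep I g = x :=
  ((cs.existsUnique_minCosetReps I g).choose_spec.2 x ⟨hx, h⟩).symm

end Parabolic

end CoxeterSystem

namespace CoxeterSystem

/-! ### The order on conjugacy classes of subsets -/

section ClassLE

variable {B W : Type*} [Group W] {M : CoxeterMatrix B} (cs : CoxeterSystem M W)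

theorem classLE_iff {I J : Finset B} :
    cs.ClassLE I J ↔ ∃ g : W, ∀ i ∈ I, ∃ j ∈ J, g * cs.simple i * g⁻¹ = cs.simple j := by
  classical
  constructor
  · rintro ⟨I', J', ⟨u, hu⟩, ⟨v, hv⟩, hsub⟩
    refine ⟨v⁻¹ * u, fun i hi => ?_⟩
    have h1 : u * cs.simple i * u⁻¹ ∈ cs.simple '' (I' : Set B) := by
      rw [hu]; exact ⟨_, ⟨i, hi, rfl⟩, rfl⟩
    obtain ⟨k, hk, hk'⟩ := h1
    have h2 : cs.simple k ∈ cs.simple '' (J' : Set B) := ⟨k, hsub hk, rfl⟩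
    rw [hv] at h2
    obtain ⟨_, ⟨j, hj, rfl⟩, hj'⟩ := h2
    refine ⟨j, hj, ?_⟩
    have h3 : v * cs.simple j * v⁻¹ = u * cs.simple i * u⁻¹ := by rw [← hk']; exact hj'
    have h4 : cs.simple j = v⁻¹ * (v * cs.simple j * v⁻¹) * v := by group
    rw [h4, h3]
    group
  · rintro ⟨g, hg⟩
    refine ⟨J.filter fun j => ∃ i ∈ I, g * cs.simple i * g⁻¹ = cs.simple j, J, ⟨g, ?_⟩,
      ⟨1, by simp⟩, Finset.filter_subset _ _⟩
    ext t
    constructor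
    · rintro ⟨j, hj, rfl⟩
      obtain ⟨_, i, hi, h⟩ := Finset.mem_filter.mp (Finset.mem_coe.mp hj)
      exact ⟨_, ⟨i, hi, rfl⟩, h⟩
    · rintro ⟨_, ⟨i, hi, rfl⟩, rfl⟩
      obtain ⟨j, hj, h⟩ := hg i hi
      exact ⟨j, Finset.mem_coe.mpr (Finset.mem_filter.mpr ⟨hj, i, hi, h⟩), h.symm⟩

theorem ClassLE.of_subset_left {I J K : Finset B} (h : cs.ClassLE I J) (hK : K ⊆ I) :
    cs.ClassLE K J := by
  rw [classLE_iff] at h ⊢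
  exact h.imp fun g hg i hi => hg i (hK hi)

theorem classLE_of_subset {I J : Finset B} (h : I ⊆ J) : cs.ClassLE I J :=
  cs.classLE_iff.mpr ⟨1, fun i hi => ⟨i, h hi, by simp⟩⟩

theorem mem_eqSaturation_of_subset {ξ : Finset B → ℚ} {K L : Finset B} (hKL : K ⊆ L)
    (hL : L ∈ cs.eqSaturation ξ) : K ∈ cs.eqSaturation ξ := by
  obtain ⟨J, hJ, hle⟩ := hL
  exact ⟨J, hJ, ClassLE.of_subset_left cs hle hKL⟩

end ClassLE

/-! ### Solomon's product formula and structure constants -/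

section Product

variable {B W : Type*} [Group W] {M : CoxeterMatrix B} (cs : CoxeterSystem M W)

open Classical in
/-- The set `J ∩ d⁻¹ I d`, for `d` a distinguished double coset representative. -/
noncomputable def conjInter (I J : Finset B) (d : W) : Finset B :=
  J.filter fun j => d * cs.simple j * d⁻¹ ∈ cs.parabolic I

theorem mem_conjInter {I J : Finset B} {d : W} {j : B} :
    j ∈ cs.conjInter I J d ↔ j ∈ J ∧ d * cs.simple j * d⁻¹ ∈ cs.parabolic I := by
  classical
  exact Finset.mem_filter

theorem conjInter_subset (I J : Finset B) (d : W) : cs.conjInter I J d ⊆ J :=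
  fun _ hj => (cs.mem_conjInter.mp hj).1

theorem invCocycle_eq_zero_of_conj_mem {I : Finset B} {d t : W} (hd : d⁻¹ ∈ cs.minCosetReps I)
    (ht : d * t * d⁻¹ ∈ cs.parabolic I) : cs.invCocycle d t = 0 := by
  rw [← invCocycle_inv]
  exact cs.invCocycle_eq_zero_of_mem_minCosetReps hd ht

/-- Additivity of length gives `ℓ(sⱼ d⁻¹) = ℓ(d⁻¹) + ℓ(d sⱼ d⁻¹)`. So the conjugate, a priori only
in `W_I`, has length 1 and is simple. -/
theorem classLE_conjInter {I J : Finset B} {d : W} (hd : d⁻¹ ∈ cs.minCosetReps I) :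
    cs.ClassLE (cs.conjInter I J d) I := by
  refine cs.classLE_iff.mpr ⟨d, fun j hj => ?_⟩
  have ht := (cs.mem_conjInter.mp hj).2
  have h1 := cs.length_mul_of_mem_minCosetReps hd ht
  have h2 : d⁻¹ * (d * cs.simple j * d⁻¹) = cs.simple j * d⁻¹ := by group
  have h3 := cs.length_mul_le (cs.simple j) d⁻¹
  rw [length_simple] at h3
  rw [h2] at h1
  have h4 : cs.length (d * cs.simple j * d⁻¹) ≠ 0 := by
    rw [Ne, length_eq_zero_iff]
    intro h
    have : cs.simple j = 1 := by
      have h5 : cs.simple j = d⁻¹ * (d * cs.simple j * d⁻¹) * d := by group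
      rw [h5, h]; group
    have h6 := cs.length_simple j
    rw [this, length_one] at h6
    exact zero_ne_one h6
  obtain ⟨i, hi⟩ := cs.length_eq_one_iff.mp (by omega : cs.length (d * cs.simple j * d⁻¹) = 1)
  exact ⟨i, cs.simple_mem_parabolic_iff.mp (hi ▸ ht), hi⟩

/-- For `x ∈ X_I`, `z ∈ W_I` and `d⁻¹ ∈ X_I`, membership of `z d` in `X_J` is read off
from `d` and from the product `x z d`. -/
theorem mul_mem_minCosetReps_iff {I J : Finset B} {x z d : W} (hx : x ∈ cs.minCosetReps I)
    (hz : z ∈ cs.parabolic I) (hd : d⁻¹ ∈ cs.minCosetReps I) :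
    z * d ∈ cs.minCosetReps J ↔
      d ∈ cs.minCosetReps J ∧ x * z * d ∈ cs.minCosetReps (cs.conjInter I J d) := by
  simp only [mem_minCosetReps_iff]
  have hin : ∀ j ∈ cs.conjInter I J d, cs.invCocycle d (cs.simple j) = 0 := fun j hj =>
    cs.invCocycle_eq_zero_of_conj_mem hd (cs.mem_conjInter.mp hj).2
  have hprod : ∀ j ∈ cs.conjInter I J d,
      cs.invCocycle (x * z * d) (cs.simple j) = cs.invCocycle (z * d) (cs.simple j) := by
    intro j hj
    have ht := (cs.mem_conjInter.mp hj).2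
    rw [mul_assoc, cs.invCocycle_mul x, cs.invCocycle_eq_zero_of_mem_minCosetReps hx, add_zero]
    have := mul_mem (mul_mem hz ht) (inv_mem hz)
    convert this using 1
    group
  -- Inversions of `z` lie in `W_I`, so `z` contributes only at indices in `conjInter I J d`.
  have hout : ∀ j ∈ J, j ∉ cs.conjInter I J d →
      cs.invCocycle (z * d) (cs.simple j) = cs.invCocycle d (cs.simple j) := by
    intro j hj hjK
    rw [invCocycle_mul]
    have : cs.invCocycle z (d * cs.simple j * d⁻¹) = 0 := by
      by_contra h
      exact hjK (cs.mem_conjInter.mpr ⟨hj, cs.mem_parabolic_of_invCocycle_ne_zero hz h⟩)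
    rw [this, add_zero]
  constructor
  · intro h
    refine ⟨fun j hj => ?_, fun j hj => ?_⟩
    · by_cases hjK : j ∈ cs.conjInter I J d
      · exact hin j hjK
      · rw [← hout j hj hjK]; exact h j hj
    · rw [hprod j hj]
      exact h j (cs.conjInter_subset I J d hj)
  · rintro ⟨h1, h2⟩ j hj
    by_cases hjK : j ∈ cs.conjInter I J d
    · rw [← hprod j hjK]; exact h2 j hjK
    · rw [hout j hj hjK]; exact h1 j hj

variable [Fintype W]

open Classical in
/-- The distinguished representatives of the double cosets `W_I d W_J`. -/
noncomputable def doubleCosetReps (I J : Finset B) : Finset W :=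
  Finset.univ.filter fun d => d⁻¹ ∈ cs.minCosetReps I ∧ d ∈ cs.minCosetReps J

theorem mem_doubleCosetReps {I J : Finset B} {d : W} :
    d ∈ cs.doubleCosetReps I J ↔ d⁻¹ ∈ cs.minCosetReps I ∧ d ∈ cs.minCosetReps J := by
  classical
  simp [doubleCosetReps]

/-- Solomon's product formula. -/
theorem descentElt_mul_descentElt (I J : Finset B) :
    cs.descentElt I * cs.descentElt J =
      ∑ d ∈ cs.doubleCosetReps I J, cs.descentElt (cs.conjInter I J d) := by
  classical
  unfold descentElt
  rw [Finset.sum_mul_sum, ← Finset.sum_product', Finset.sum_sigma']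
  have hrep : ∀ v : W, (cs.cosetRep I v⁻¹)⁻¹⁻¹ ∈ cs.minCosetReps I := fun v => by
    rw [inv_inv]; exact cs.cosetRep_mem I _
  have hpar : ∀ v : W, v * cs.cosetRep I v⁻¹ ∈ cs.parabolic I := fun v => by
    have := inv_mem (cs.cosetRep_inv_mul_mem I v⁻¹)
    convert this using 1
    group
  -- Send `(x, v)` to `(d, x v)` with `d` the shortest element of `W_I v`. Conversely, `x` is the
  -- `X_I` representative of `w d⁻¹`.
  refine Finset.sum_bij' (fun p _ => (⟨(cs.cosetRep I p.2⁻¹)⁻¹, p.1 * p.2⟩ : Σ _ : W, W))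
    (fun q _ => (cs.cosetRep I (q.2 * q.1⁻¹), (cs.cosetRep I (q.2 * q.1⁻¹))⁻¹ * q.2))
    ?_ ?_ ?_ ?_ ?_
  · rintro ⟨x, v⟩ hp
    simp only [Finset.mem_product, Finset.mem_filter, Finset.mem_univ, true_and] at hp
    have hz := hpar v
    have h := (cs.mul_mem_minCosetReps_iff (J := J) hp.1 hz (hrep v)).mp (by simpa using hp.2)
    simp only [Finset.mem_sigma, mem_doubleCosetReps, Finset.mem_filter, Finset.mem_univ, true_and]
    refine ⟨⟨hrep v, h.1⟩, ?_⟩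
    have h2 := h.2
    rwa [mul_assoc x, mul_assoc v, mul_inv_cancel, mul_one] at h2
  · rintro ⟨d, w⟩ hq
    simp only [Finset.mem_sigma, mem_doubleCosetReps, Finset.mem_filter, Finset.mem_univ,
      true_and] at hq
    obtain ⟨⟨hd, hdJ⟩, hw⟩ := hq
    simp only [Finset.mem_product, Finset.mem_filter, Finset.mem_univ, true_and]
    refine ⟨cs.cosetRep_mem I _, ?_⟩
    have h := (cs.mul_mem_minCosetReps_iff (J := J) (cs.cosetRep_mem I (w * d⁻¹))
      (cs.cosetRep_inv_mul_mem I (w * d⁻¹)) hd).mpr ⟨hdJ, by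
        rwa [mul_inv_cancel_left, inv_mul_cancel_right]⟩
    rwa [mul_assoc, inv_mul_cancel_right] at h
  · rintro ⟨x, v⟩ hp
    simp only [Finset.mem_product, Finset.mem_filter, Finset.mem_univ, true_and] at hp
    have : cs.cosetRep I (x * v * (cs.cosetRep I v⁻¹)⁻¹⁻¹) = x := by
      apply cs.cosetRep_eq hp.1
      rw [inv_inv, mul_assoc x, inv_mul_cancel_left]
      exact hpar v
    simp only [this, inv_mul_cancel_left]
  · rintro ⟨d, w⟩ hq
    simp only [Finset.mem_sigma, mem_doubleCosetReps, Finset.mem_filter, Finset.mem_univ,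
      true_and] at hq
    have : cs.cosetRep I ((cs.cosetRep I (w * d⁻¹))⁻¹ * w)⁻¹ = d⁻¹ := by
      apply cs.cosetRep_eq hq.1.1
      have := inv_mem (cs.cosetRep_inv_mul_mem I (w * d⁻¹))
      convert this using 1
      group
    simp only [this, inv_inv, mul_inv_cancel_left]
  · rintro ⟨x, v⟩ hp
    simp

open Classical in
/-- The structure constants of the descent algebra in the basis of the `x_I`. -/
noncomputable def structConst (I J K : Finset B) : ℚ :=
  ((cs.doubleCosetReps I J).filter fun d => cs.conjInter I J d = K).card

theorem structConst_nonneg (I J K : Finset B) : 0 ≤ cs.structConst I J K :=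
  Nat.cast_nonneg _

theorem descentElt_mul_eq_sum_structConst [Fintype B] (I J : Finset B) :
    cs.descentElt I * cs.descentElt J = ∑ K, cs.structConst I J K • cs.descentElt K := by
  classical
  rw [descentElt_mul_descentElt, ← Finset.sum_fiberwise (cs.doubleCosetReps I J)
    (fun d => cs.conjInter I J d)]
  refine Finset.sum_congr rfl fun K _ => ?_
  rw [Finset.sum_congr rfl fun d hd => by rw [(Finset.mem_filter.mp hd).2], Finset.sum_const,
    structConst, Nat.cast_smul_eq_nsmul]

theorem exists_of_structConst_ne_zero {I J K : Finset B} (h : cs.structConst I J K ≠ 0) :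
    ∃ d ∈ cs.doubleCosetReps I J, cs.conjInter I J d = K := by
  classical
  rw [structConst, Nat.cast_ne_zero, Finset.card_ne_zero] at h
  obtain ⟨d, hd⟩ := h
  exact ⟨d, Finset.mem_filter.mp hd⟩

theorem subset_of_structConst_ne_zero {I J K : Finset B} (h : cs.structConst I J K ≠ 0) :
    K ⊆ J := by
  obtain ⟨d, -, rfl⟩ := cs.exists_of_structConst_ne_zero h
  exact cs.conjInter_subset I J d

theorem classLE_of_structConst_ne_zero {I J K : Finset B} (h : cs.structConst I J K ≠ 0) :
    cs.ClassLE K I := by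
  obtain ⟨d, hd, rfl⟩ := cs.exists_of_structConst_ne_zero h
  exact cs.classLE_conjInter (cs.mem_doubleCosetReps.mp hd).1

/-- If `g` conjugates `J` into `I`, the shortest element `d` of `W_I g` conjugates `J` into `W_I`,
so it is counted. -/
theorem structConst_self_pos {I J : Finset B} (h : cs.ClassLE J I) : 0 < cs.structConst I J J := by
  classical
  obtain ⟨g, hg⟩ := cs.classLE_iff.mp h
  rw [structConst, Nat.cast_pos, Finset.card_pos]
  set d : W := (cs.cosetRep I g⁻¹)⁻¹ with hd
  have hdI : d⁻¹ ∈ cs.minCosetReps I := by rw [hd, inv_inv]; exact cs.cosetRep_mem I _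
  have hz : d * g⁻¹ ∈ cs.parabolic I := cs.cosetRep_inv_mul_mem I g⁻¹
  have hconj : ∀ j ∈ J, d * cs.simple j * d⁻¹ ∈ cs.parabolic I := by
    intro j hj
    obtain ⟨i, hi, hij⟩ := hg j hj
    have := mul_mem (mul_mem hz (cs.simple_mem_parabolic hi)) (inv_mem hz)
    rw [← hij] at this
    convert this using 1
    group
  refine ⟨d, Finset.mem_filter.mpr ⟨cs.mem_doubleCosetReps.mpr ⟨hdI, ?_⟩, ?_⟩⟩
  · exact cs.mem_minCosetReps_iff.mpr fun j hj => cs.invCocycle_eq_zero_of_conj_mem hdI (hconj j hj)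
  · exact (cs.conjInter_subset I J d).antisymm fun j hj => cs.mem_conjInter.mpr ⟨hj, hconj j hj⟩

/-- For every `J` some element, the longest one of the parabolic subgroup of the complement,
has exactly the elements of `J` as its non-descents. -/
theorem exists_mem_minCosetReps_iff_subset [Fintype B] (J : Finset B) :
    ∃ w : W, ∀ I, w ∈ cs.minCosetReps I ↔ I ⊆ J := by
  classical
  obtain ⟨z, -, hz⟩ := Finset.exists_max_image (Finset.univ : Finset (cs.parabolic Jᶜ))
    (fun z => cs.length (z : W)) ⟨1, Finset.mem_univ _⟩
  refine ⟨z, fun I => ?_⟩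
  rw [mem_minCosetReps_iff]
  constructor
  · intro h i hi
    by_contra hiJ
    have hs := cs.simple_mem_parabolic (Finset.mem_compl.mpr hiJ)
    have h1 := (cs.invCocycle_eq_zero_iff (cs.isReflection_simple i)).mp (h i hi)
    exact absurd (hz (z * ⟨_, hs⟩) (Finset.mem_univ _)) (not_le_of_gt h1)
  · intro h i hi
    by_contra h0
    exact Finset.mem_compl.mp
      (cs.simple_mem_parabolic_iff.mp (cs.mem_parabolic_of_invCocycle_ne_zero z.2 h0)) (h hi)

open Classical in
theorem coeff_descentElt (I : Finset B) (w : W) :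
    (cs.descentElt I).coeff w = if w ∈ cs.minCosetReps I then 1 else 0 := by
  simp [descentElt, Finsupp.single_apply, Finset.sum_ite_eq']

/-- The coefficient at an element with non-descent set `J` gives `∑_{I ⊆ J} c_I = 0`; induct on `J`.
-/
theorem linearIndependent_descentElt [Fintype B] : LinearIndependent ℚ cs.descentElt := by
  classical
  rw [Fintype.linearIndependent_iff]
  intro c hc
  have h : ∀ J : Finset B, ∑ I ∈ J.powerset, c I = 0 := by
    intro J
    obtain ⟨w, hw⟩ := cs.exists_mem_minCosetReps_iff_subset J
    have := congrArg (fun f : MonoidAlgebra ℚ W => f.coeff w) hc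
    simp only [MonoidAlgebra.coeff_sum, MonoidAlgebra.coeff_smul, Finsupp.coe_finsetSum,
      Finset.sum_apply, Finsupp.smul_apply, coeff_descentElt, hw, smul_eq_mul, mul_ite, mul_one,
      mul_zero, MonoidAlgebra.coeff_zero, Finsupp.coe_zero, Pi.zero_apply] at this
    rw [← Finset.sum_filter] at this
    rw [← this]
    exact Finset.sum_congr (by ext; simp) fun _ _ => rfl
  intro J
  induction J using Finset.strongInduction with
  | H J ih =>
    have := h J
    rwa [← Finset.insert_erase (Finset.mem_powerset_self J),
      Finset.sum_insert (Finset.notMem_erase _ _), Finset.sum_eq_zero, add_zero] at this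
    intro K hK
    rw [Finset.mem_erase, Finset.mem_powerset] at hK
    exact ih K (hK.2.ssubset_of_ne hK.1)

theorem descentElt_univ [Fintype B] : cs.descentElt Finset.univ = 1 := by
  classical
  have : (Finset.univ.filter fun w : W => w ∈ cs.minCosetReps Finset.univ) = {1} := by
    ext w
    simp only [Finset.mem_filter, Finset.mem_univ, true_and, Finset.mem_singleton]
    constructor
    · intro h
      by_contra h1
      obtain ⟨j, hj⟩ := cs.exists_rightDescent_of_ne_one h1
      exact absurd (h j (Finset.mem_univ j)) (not_lt_of_gt hj)
    · rintro rfl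
      exact cs.mem_minCosetReps_iff.mpr fun i _ => cs.invCocycle_one _
  rw [descentElt, this, Finset.sum_singleton, map_one]

end Product

end CoxeterSystem

/-! ### Commutation with powers of triangular matrices -/

section Triangular

variable {ι : Type*} [PartialOrder ι]

/-- The matrices supported on the pairs `i ≤ j`. -/
def Matrix.SupportedLE (U : Matrix ι ι ℚ) : Prop := ∀ i j, U i j ≠ 0 → i ≤ j

namespace Matrix.SupportedLE

variable [Fintype ι] {U V : Matrix ι ι ℚ}

theorem mul (hU : U.SupportedLE) (hV : V.SupportedLE) : (U * V).SupportedLE := by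
  intro i j h
  rw [Matrix.mul_apply] at h
  obtain ⟨k, -, hk⟩ := Finset.exists_ne_zero_of_sum_ne_zero h
  exact (hU _ _ (left_ne_zero_of_mul hk)).trans (hV _ _ (right_ne_zero_of_mul hk))

theorem mul_apply_self (hU : U.SupportedLE) (hV : V.SupportedLE) (i : ι) :
    (U * V) i i = U i i * V i i := by
  rw [Matrix.mul_apply]
  refine Finset.sum_eq_single i (fun k _ hk => ?_) (by simp)
  by_contra h
  exact hk ((hV _ _ (right_ne_zero_of_mul h)).antisymm (hU _ _ (left_ne_zero_of_mul h)))

variable [DecidableEq ι]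

theorem pow (hU : U.SupportedLE) (n : ℕ) : (U ^ n).SupportedLE := by
  induction n with
  | zero =>
    intro i j h
    rw [pow_zero, Matrix.one_apply] at h
    exact (of_not_not fun hij => h (if_neg hij)).le
  | succ n ih => rw [pow_succ]; exact ih.mul hU

theorem pow_apply_self (hU : U.SupportedLE) (n : ℕ) (i : ι) : (U ^ n) i i = U i i ^ n := by
  induction n with
  | zero => simp
  | succ n ih => rw [pow_succ, (hU.pow n).mul_apply_self hU, ih, pow_succ]

/-- A triangular matrix with non-negative diagonal entries whose rows vanish outside a lower set,
on which the diagonal entries are positive, commutes with every triangular matrix that commutes with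
one of its positive powers. -/
theorem mul_comm_of_pow_mul_comm {A X : Matrix ι ι ℚ} (hA : A.SupportedLE) (hX : X.SupportedLE)
    {rk : ι → ℕ} (hrk : StrictMono rk) {F : Set ι} (hF : IsLowerSet F)
    (hrow : ∀ i ∉ F, ∀ j, A i j = 0) (hdiag : ∀ i ∈ F, 0 < A i i) {n : ℕ} (hn : 1 ≤ n)
    (h : A ^ n * X = X * A ^ n) : A * X = X * A := by
  have hnonneg : ∀ i, 0 ≤ A i i := fun i => by
    by_cases hi : i ∈ F
    · exact (hdiag i hi).le
    · exact (hrow i hi i).ge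
  set Y : Matrix ι ι ℚ := A * X - X * A with hY
  have htel : ∑ i ∈ Finset.range n, A ^ i * Y * A ^ (n - 1 - i) = 0 := by
    have h1 : ∀ i ∈ Finset.range n, A ^ i * Y * A ^ (n - 1 - i) =
        A ^ (i + 1) * X * A ^ (n - (i + 1)) - A ^ i * X * A ^ (n - i) := by
      intro i hi
      have hi := Finset.mem_range.mp hi
      rw [show n - i = n - 1 - i + 1 by omega, show n - (i + 1) = n - 1 - i by omega, hY,
        pow_succ A i, pow_succ' A (n - 1 - i)]
      noncomm_ring
    rw [Finset.sum_congr rfl h1, Finset.sum_range_sub fun i => A ^ i * X * A ^ (n - i)]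
    simp [h]
  have hYsupp : Y.SupportedLE := by
    intro i j hij
    by_contra hle
    have h1 : (A * X) i j = 0 := of_not_not fun h0 => hle (hA.mul hX i j h0)
    have h2 : (X * A) i j = 0 := of_not_not fun h0 => hle (hX.mul hA i j h0)
    exact hij (by rw [hY, Matrix.sub_apply, h1, h2, sub_zero])
  -- Row `i` of `X A` involves only rows `k ≥ i` of `A`; these vanish, because `k ∈ F` would put `i`
  -- in the lower set `F`.
  have hYrow : ∀ i ∉ F, ∀ j, Y i j = 0 := by
    intro i hi j
    rw [hY, Matrix.sub_apply, Matrix.mul_apply, Matrix.mul_apply, Finset.sum_eq_zero,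
      Finset.sum_eq_zero, sub_zero]
    · intro k _
      by_contra h0
      have hk : k ∈ F := of_not_not fun hk => right_ne_zero_of_mul h0 (hrow k hk j)
      exact hi (hF (hX _ _ (left_ne_zero_of_mul h0)) hk)
    · intro k _
      rw [hrow i hi, zero_mul]
  -- Truncated subtraction is harmless, since `Y i j` vanishes unless `i ≤ j`.
  have key : ∀ d : ℕ, ∀ i j, rk j - rk i = d → Y i j = 0 := by
    intro d
    induction d using Nat.strong_induction_on with
    | _ d ih =>
    intro i j hd
    by_contra hne
    have hij := hYsupp i j hne
    have hi : i ∈ F := of_not_not fun hi => hne (hYrow i hi j)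
    have hterm : ∀ p ∈ Finset.range n, (A ^ p * Y * A ^ (n - 1 - p)) i j =
        A i i ^ p * A j j ^ (n - 1 - p) * Y i j := by
      intro p _
      -- Any other `Y k l` in the triple product has `i ≤ k ≤ l ≤ j`, with a strictly smaller rank
      -- gap.
      have hzero : ∀ k l, i ≤ k → l ≤ j → (k ≠ i ∨ l ≠ j) → Y k l = 0 := by
        intro k l hik hlj hkl
        by_contra h0
        have hkl' := hYsupp k l h0
        refine h0 (ih _ ?_ k l rfl)
        have m1 := hrk.monotone hik
        have m2 := hrk.monotone hlj
        have m3 := hrk.monotone hkl'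
        rcases hkl with hk | hl
        · have := hrk (lt_of_le_of_ne hik (Ne.symm hk))
          omega
        · have := hrk (lt_of_le_of_ne hlj hl)
          omega
      rw [Matrix.mul_apply, Finset.sum_eq_single j, Matrix.mul_apply, Finset.sum_eq_single i,
        hA.pow_apply_self, hA.pow_apply_self]
      · ring
      · intro k _ hk
        by_contra h0
        exact right_ne_zero_of_mul h0
          (hzero k j ((hA.pow p) _ _ (left_ne_zero_of_mul h0)) le_rfl (Or.inl hk))
      · simp
      · intro l _ hl
        by_contra h0
        have hlj := (hA.pow (n - 1 - p)) _ _ (right_ne_zero_of_mul h0)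
        refine left_ne_zero_of_mul h0 ?_
        rw [Matrix.mul_apply]
        refine Finset.sum_eq_zero fun k _ => ?_
        by_contra h1
        exact right_ne_zero_of_mul h1
          (hzero k l ((hA.pow p) _ _ (left_ne_zero_of_mul h1)) hlj (Or.inr hl))
      · simp
    have hsum := congrFun (congrFun htel i) j
    rw [Matrix.sum_apply, Finset.sum_congr rfl hterm, ← Finset.sum_mul, Matrix.zero_apply] at hsum
    refine hne ((mul_eq_zero.mp hsum).resolve_left (ne_of_gt ?_))
    -- As `A j j` may be zero, positivity comes from `p = n - 1`, where its exponent is zero.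
    refine Finset.sum_pos' (fun p _ => mul_nonneg (pow_nonneg (hnonneg i) _)
      (pow_nonneg (hnonneg j) _)) ⟨n - 1, Finset.mem_range.mpr (by omega), ?_⟩
    rw [Nat.sub_self, pow_zero, mul_one]
    exact pow_pos (hdiag i hi) _
  refine sub_eq_zero.mp ?_
  ext i j
  exact key _ i j rfl

end Matrix.SupportedLE

end Triangular

/-! ### Multiplication matrices, the saturation span and dimensions -/

namespace CoxeterSystem

variable {B W : Type*} [Group W] [Fintype W] {M : CoxeterMatrix B} (cs : CoxeterSystem M W)

theorem descentElt_mem (I : Finset B) : cs.descentElt I ∈ cs.descentSpace :=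
  Submodule.subset_span ⟨I, rfl⟩

theorem mem_descentCentralizer {a x : MonoidAlgebra ℚ W} :
    x ∈ cs.descentCentralizer a ↔ x ∈ cs.descentSpace ∧ a * x = x * a := by
  simp [descentCentralizer, Subalgebra.mem_centralizer_iff]

/-- The span of the `x_I` with `I ∈ F_eq(a)`. -/
noncomputable def saturationSpan (ξ : Finset B → ℚ) : Submodule ℚ (MonoidAlgebra ℚ W) :=
  Submodule.span ℚ (cs.descentElt '' cs.eqSaturation ξ)

theorem descentElt_mem_saturationSpan {ξ : Finset B → ℚ} {K : Finset B}
    (hK : K ∈ cs.eqSaturation ξ) : cs.descentElt K ∈ cs.saturationSpan ξ :=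
  Submodule.subset_span ⟨K, hK, rfl⟩

variable [Fintype B]

/-- The matrix of left multiplication by `∑ ζ_I x_I` in the basis of the `x_J`. -/
noncomputable def structMatrix (ζ : Finset B → ℚ) : Matrix (Finset B) (Finset B) ℚ :=
  Matrix.of fun K J => ∑ I, ζ I * cs.structConst I J K

theorem structMatrix_apply (ζ : Finset B → ℚ) (K J : Finset B) :
    cs.structMatrix ζ K J = ∑ I, ζ I * cs.structConst I J K :=
  rfl

theorem sum_smul_descentElt_mul (ζ : Finset B → ℚ) (J : Finset B) :
    (∑ I, ζ I • cs.descentElt I) * cs.descentElt J =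
      ∑ K, cs.structMatrix ζ K J • cs.descentElt K := by
  simp only [structMatrix_apply, Finset.sum_smul, Finset.sum_mul, smul_mul_assoc,
    descentElt_mul_eq_sum_structConst, Finset.smul_sum, smul_smul]
  exact Finset.sum_comm

theorem mul_mul_descentElt {u v : MonoidAlgebra ℚ W} {U V : Matrix (Finset B) (Finset B) ℚ}
    (hu : ∀ J, u * cs.descentElt J = ∑ K, U K J • cs.descentElt K)
    (hv : ∀ J, v * cs.descentElt J = ∑ K, V K J • cs.descentElt K) (J : Finset B) :
    u * v * cs.descentElt J = ∑ K, (U * V) K J • cs.descentElt K := by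
  rw [mul_assoc, hv, Finset.mul_sum]
  simp only [mul_smul_comm, hu, Finset.smul_sum, smul_smul, Matrix.mul_apply, Finset.sum_smul]
  rw [Finset.sum_comm]
  simp only [mul_comm]

theorem pow_mul_descentElt [DecidableEq B] {u : MonoidAlgebra ℚ W}
    {U : Matrix (Finset B) (Finset B) ℚ}
    (hu : ∀ J, u * cs.descentElt J = ∑ K, U K J • cs.descentElt K) (n : ℕ) (J : Finset B) :
    u ^ n * cs.descentElt J = ∑ K, (U ^ n) K J • cs.descentElt K := by
  induction n generalizing J with
  | zero => simp [Matrix.one_apply]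
  | succ n ih => rw [pow_succ, pow_succ]; exact cs.mul_mul_descentElt ih hu J

theorem matrix_eq_of_mul_descentElt_eq {u : MonoidAlgebra ℚ W}
    {U V : Matrix (Finset B) (Finset B) ℚ}
    (hU : ∀ J, u * cs.descentElt J = ∑ K, U K J • cs.descentElt K)
    (hV : ∀ J, u * cs.descentElt J = ∑ K, V K J • cs.descentElt K) : U = V := by
  ext K J
  exact congrFun (cs.linearIndependent_descentElt.fintypeLinearCombination_injective
    (a₁ := fun K => U K J) (a₂ := fun K => V K J) (by
      simp only [Fintype.linearCombination_apply]; rw [← hU, ← hV])) K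

/-- The matrix determines the element because `x_S = 1`. -/
theorem eq_of_mul_descentElt_eq {u v : MonoidAlgebra ℚ W}
    {U : Matrix (Finset B) (Finset B) ℚ}
    (hu : ∀ J, u * cs.descentElt J = ∑ K, U K J • cs.descentElt K)
    (hv : ∀ J, v * cs.descentElt J = ∑ K, U K J • cs.descentElt K) : u = v := by
  have := (hu Finset.univ).trans (hv Finset.univ).symm
  rwa [descentElt_univ, mul_one, mul_one] at this

theorem mem_descentSpace_iff {x : MonoidAlgebra ℚ W} :
    x ∈ cs.descentSpace ↔ ∃ ζ : Finset B → ℚ, ∑ I, ζ I • cs.descentElt I = x :=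
  Submodule.mem_span_range_iff_exists_fun ℚ

theorem finrank_descentSpace : Module.finrank ℚ cs.descentSpace = 2 ^ Fintype.card B := by
  rw [descentSpace, finrank_span_eq_card cs.linearIndependent_descentElt, Fintype.card_finset]

theorem structMatrix_supportedLE (ζ : Finset B → ℚ) : (cs.structMatrix ζ).SupportedLE := by
  intro K J h
  obtain ⟨I, -, hI⟩ := Finset.exists_ne_zero_of_sum_ne_zero h
  exact cs.subset_of_structConst_ne_zero (right_ne_zero_of_mul hI)

variable {cs}

theorem structMatrix_eq_zero {ξ : Finset B → ℚ} {K : Finset B} (hK : K ∉ cs.eqSaturation ξ)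
    (J : Finset B) : cs.structMatrix ξ K J = 0 := by
  refine Finset.sum_eq_zero fun I _ => ?_
  by_contra h
  exact hK ⟨I, left_ne_zero_of_mul h,
    cs.classLE_of_structConst_ne_zero (right_ne_zero_of_mul h)⟩

theorem structMatrix_self_pos {ξ : Finset B → ℚ} (hξ : ∀ I, 0 ≤ ξ I) {K : Finset B}
    (hK : K ∈ cs.eqSaturation ξ) : 0 < cs.structMatrix ξ K K := by
  obtain ⟨I, hI, hle⟩ := hK
  exact Finset.sum_pos' (fun I _ => mul_nonneg (hξ I) (cs.structConst_nonneg I K K))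
    ⟨I, Finset.mem_univ I, mul_pos ((hξ I).lt_of_ne' hI) (cs.structConst_self_pos hle)⟩

theorem mul_comm_of_pow_mul_comm {ξ : Finset B → ℚ} (hξ : ∀ I, 0 ≤ ξ I)
    {a x : MonoidAlgebra ℚ W} (ha : a = ∑ I, ξ I • cs.descentElt I) (hx : x ∈ cs.descentSpace)
    {n : ℕ} (hn : 1 ≤ n) (h : a ^ n * x = x * a ^ n) : a * x = x * a := by
  classical
  obtain ⟨ζ, rfl⟩ := cs.mem_descentSpace_iff.mp hx
  have hA := fun J => cs.sum_smul_descentElt_mul ξ J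
  rw [← ha] at hA
  have hX := fun J => cs.sum_smul_descentElt_mul ζ J
  have hAn := cs.pow_mul_descentElt hA n
  have h1 := cs.mul_mul_descentElt hAn hX
  rw [h] at h1
  have hmat := cs.matrix_eq_of_mul_descentElt_eq h1 (cs.mul_mul_descentElt hX hAn)
  have hcomm := Matrix.SupportedLE.mul_comm_of_pow_mul_comm (cs.structMatrix_supportedLE ξ)
    (cs.structMatrix_supportedLE ζ) (rk := Finset.card) Finset.card_strictMono
    (F := cs.eqSaturation ξ) (fun _ _ hab hb => cs.mem_eqSaturation_of_subset hab hb)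
    (fun _ hi => structMatrix_eq_zero hi) (fun _ hi => structMatrix_self_pos hξ hi) hn hmat
  refine cs.eq_of_mul_descentElt_eq (cs.mul_mul_descentElt hA hX) ?_
  rw [hcomm]
  exact cs.mul_mul_descentElt hX hA

theorem finrank_saturationSpan (ξ : Finset B → ℚ) :
    Module.finrank ℚ (cs.saturationSpan ξ) = (cs.eqSaturation ξ).ncard := by
  classical
  rw [saturationSpan, ← Set.ncard_image_of_injective _ cs.linearIndependent_descentElt.injective,
    Set.ncard_eq_toFinset_card']
  exact finrank_span_set_eq_card
    (cs.linearIndependent_descentElt.linearIndepOn (cs.eqSaturation ξ)).id_image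

/-- For `a x`, the rows of the matrix of `a` outside `F_eq(a)` vanish. For `x a`, only `x_K` with `K
⊆ J` and `ξ J ≠ 0` occur. -/
theorem mul_mem_saturationSpan {ξ : Finset B → ℚ} {a x : MonoidAlgebra ℚ W}
    (ha : a = ∑ I, ξ I • cs.descentElt I) (hx : x ∈ cs.descentSpace) :
    a * x ∈ cs.saturationSpan ξ ∧ x * a ∈ cs.saturationSpan ξ := by
  obtain ⟨ζ, rfl⟩ := cs.mem_descentSpace_iff.mp hx
  constructor
  · rw [Finset.mul_sum]
    refine Submodule.sum_mem _ fun J _ => ?_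
    rw [mul_smul_comm, ha, sum_smul_descentElt_mul]
    refine Submodule.smul_mem _ _ (Submodule.sum_mem _ fun K _ => ?_)
    by_cases hK : K ∈ cs.eqSaturation ξ
    · exact Submodule.smul_mem _ _ (cs.descentElt_mem_saturationSpan hK)
    · rw [structMatrix_eq_zero hK, zero_smul]
      exact Submodule.zero_mem _
  · rw [ha, Finset.mul_sum]
    refine Submodule.sum_mem _ fun J _ => ?_
    rw [mul_smul_comm]
    by_cases hJ : ξ J = 0
    · rw [hJ, zero_smul]
      exact Submodule.zero_mem _
    rw [sum_smul_descentElt_mul]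
    refine Submodule.smul_mem _ _ (Submodule.sum_mem _ fun K _ => ?_)
    by_cases hK : cs.structMatrix ζ K J = 0
    · rw [hK, zero_smul]
      exact Submodule.zero_mem _
    · exact Submodule.smul_mem _ _ (cs.descentElt_mem_saturationSpan
        ⟨J, hJ, cs.classLE_of_subset (cs.structMatrix_supportedLE ζ K J hK)⟩)

/-- Triangularity and the positive diagonal allow solving for `x_J` from `a x_J` and the `x_K` with
`K ⊂ J`, already obtained. -/
theorem saturationSpan_le {ξ : Finset B → ℚ} (hξ : ∀ I, 0 ≤ ξ I) {a : MonoidAlgebra ℚ W}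
    (ha : a = ∑ I, ξ I • cs.descentElt I) :
    cs.saturationSpan ξ ≤ cs.descentSpace.map (LinearMap.mulLeft ℚ a) := by
  classical
  rw [saturationSpan, Submodule.span_le]
  rintro _ ⟨J, hJ, rfl⟩
  induction J using Finset.strongInduction with
  | H J ih =>
    have hpos := structMatrix_self_pos hξ hJ
    have h1 : a * cs.descentElt J ∈ cs.descentSpace.map (LinearMap.mulLeft ℚ a) :=
      ⟨_, cs.descentElt_mem J, rfl⟩
    have h2 : ∑ K ∈ Finset.univ.erase J, cs.structMatrix ξ K J • cs.descentElt K ∈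
        cs.descentSpace.map (LinearMap.mulLeft ℚ a) := by
      refine Submodule.sum_mem _ fun K hK => ?_
      by_cases h0 : cs.structMatrix ξ K J = 0
      · rw [h0, zero_smul]
        exact Submodule.zero_mem _
      · have hKJ : K ⊆ J := cs.structMatrix_supportedLE ξ K J h0
        exact Submodule.smul_mem _ _ (ih K (hKJ.ssubset_of_ne (Finset.ne_of_mem_erase hK))
          (cs.mem_eqSaturation_of_subset hKJ hJ))
    have h3 := Submodule.sub_mem _ h1 h2
    have hmul := cs.sum_smul_descentElt_mul ξ J
    rw [← ha] at hmul
    rw [hmul, ← Finset.add_sum_erase _ _ (Finset.mem_univ J),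
      add_sub_cancel_right] at h3
    have h4 := Submodule.smul_mem _ (cs.structMatrix ξ J J)⁻¹ h3
    rwa [smul_smul, inv_mul_cancel₀ hpos.ne', one_smul] at h4

theorem descentCommRange_sup_descentMulRight {ξ : Finset B → ℚ} (hξ : ∀ I, 0 ≤ ξ I)
    {a : MonoidAlgebra ℚ W} (ha : a = ∑ I, ξ I • cs.descentElt I) :
    cs.descentCommRange a ⊔ cs.descentMulRight a = cs.saturationSpan ξ := by
  apply le_antisymm
  · refine sup_le ?_ ?_
    · rintro _ ⟨x, hx, rfl⟩
      have := mul_mem_saturationSpan ha hx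
      exact Submodule.sub_mem _ this.1 this.2
    · rintro _ ⟨x, hx, rfl⟩
      exact (mul_mem_saturationSpan ha hx).2
  · refine (saturationSpan_le hξ ha).trans ?_
    rintro _ ⟨x, hx, rfl⟩
    refine Submodule.mem_sup.mpr ⟨a * x - x * a, ⟨x, hx, rfl⟩, x * a, ⟨x, hx, rfl⟩, ?_⟩
    simp

theorem finrank_descentCommRange_add (a : MonoidAlgebra ℚ W) :
    Module.finrank ℚ (cs.descentCommRange a) + Module.finrank ℚ (cs.descentCentralizer a) =
      2 ^ Fintype.card B := by
  set f : MonoidAlgebra ℚ W →ₗ[ℚ] MonoidAlgebra ℚ W :=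
    LinearMap.mulLeft ℚ a - LinearMap.mulRight ℚ a with hf
  have h := LinearMap.finrank_range_add_finrank_ker (f.domRestrict cs.descentSpace)
  have hmap : cs.descentCentralizer a =
      (LinearMap.ker (f.domRestrict cs.descentSpace)).map cs.descentSpace.subtype := by
    ext x
    rw [cs.mem_descentCentralizer, Submodule.mem_map]
    constructor
    · rintro ⟨hx, hax⟩
      exact ⟨⟨x, hx⟩, by simp [hf, hax], rfl⟩
    · rintro ⟨y, hy, rfl⟩
      refine ⟨y.2, ?_⟩
      simpa [hf, sub_eq_zero] using hy
  rw [hmap, (Submodule.equivMapOfInjective _ cs.descentSpace.injective_subtype _).symm.finrank_eq,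
    ← cs.finrank_descentSpace, ← h, LinearMap.range_domRestrict]
  rfl

end CoxeterSystem

theorem mainTheorem12 {B W : Type*} [Fintype B] [Group W] [Fintype W] {M : CoxeterMatrix B}
    (cs : CoxeterSystem M W) (a : MonoidAlgebra ℚ W) (ha : a ∈ cs.descentPos) :
    (∀ n : ℕ, 1 ≤ n → cs.descentCentralizer (a ^ n) = cs.descentCentralizer a) ∧
    (∀ ξ : Finset B → ℚ, a = ∑ I, ξ I • cs.descentElt I →
      (Module.finrank ℚ (cs.descentCentralizer a) : ℤ) =
        2 ^ Fintype.card B - ((cs.eqSaturation ξ).ncard : ℤ)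
          + Module.finrank ℚ (cs.descentMulRight a)
          - Module.finrank ℚ
              (cs.descentCommRange a ⊓ cs.descentMulRight a : Submodule ℚ (MonoidAlgebra ℚ W))) := by
  obtain ⟨ξ₀, hξ₀, ha₀⟩ := ha
  refine ⟨fun n hn => ?_, fun ξ hξ => ?_⟩
  · ext x
    rw [cs.mem_descentCentralizer, cs.mem_descentCentralizer]
    refine and_congr_right fun hx => ⟨CoxeterSystem.mul_comm_of_pow_mul_comm hξ₀ ha₀ hx hn, ?_⟩
    intro h
    exact Commute.pow_left h n
  -- Coordinates are unique, so the given `ξ` inherits non-negativity.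
  · have hξ' : ξ = ξ₀ := cs.linearIndependent_descentElt.fintypeLinearCombination_injective (by
      simp only [Fintype.linearCombination_apply]; rw [← hξ, ← ha₀])
    rw [← hξ'] at hξ₀
    have h1 := Submodule.finrank_sup_add_finrank_inf_eq (cs.descentCommRange a)
      (cs.descentMulRight a)
    rw [CoxeterSystem.descentCommRange_sup_descentMulRight hξ₀ hξ,
      CoxeterSystem.finrank_saturationSpan] at h1
    have h2 := CoxeterSystem.finrank_descentCommRange_add (cs := cs) a
    zify at h1 h2
    linarith
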